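/- Let $n\ge 1$ and let $M\in \mathrm{SL}(2n+1,\mathbb Z)$ be a matrix of type II, i.e. $M$ has exactly one real eigenvalue $\alpha$, and $\alpha$ is irrational and simple (a simple root of the characteristic polynomial); then automatically $\alpha>0$. Suppose that $M$ is not diagonalizable over $\mathbb C$. The manifold $T_M$ is defined as follows. Let $a=(a^{(1)},\dots,a^{(2n+1)})\in\mathbb R^{2n+1}$ be an eigenvector of $M$ for $\alpha$, let $W\subset\mathbb C^{2n+1}$ be the sum of the generalized eigenspaces of $M$ for the eigenvalues $\beta$ with $\operatorname{Im}\beta>0$, let $b_1,\dots,b_n$ be a basis of $W$, with $b_j=(b_j^{(1)},\dots,b_j^{(2n+1)})$, and let $R=(r_{\ell j})$ be the matrix with $Mb_j=\sum_{\ell} r_{\ell j}b_\ell$. Let $\mathbb H$ be the upper half-plane and let $G_M$ be the group of automorphisms of $\mathbb H\times\mathbb C^n$ generated by $g_0(w,z)=(\alpha w,R^{\top}z)$ and $g_i(w,z)=(w+a^{(i)},\,z+(b_1^{(i)},\dots,b_n^{(i)})^{\top})$ for $1\le i\le 2n+1$. Then $T_M=(\mathbb H\times\mathbb C^n)/G_M$.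 The Oeljeklaus–Toma manifolds $X(K,U)$ are defined as follows. Let $K$ be a number field with real embeddings $\sigma_1,\dots,\sigma_s$ and $t$ conjugate pairs of non-real embeddings, and let $\sigma_{s+1},\dots,\sigma_{s+t}$ be non-real embeddings, one from each pair. Let $\mathcal O_K^{*,+}$ be the group of units $u$ of the ring of integers $\mathcal O_K$ with $\sigma_i(u)>0$ for all $i\le s$. Let $U\subset\mathcal O_K^{*,+}$ be an admissible subgroup, i.e. the map $u\mapsto(\log\sigma_1(u),\dots,\log\sigma_s(u))$ sends $U$ isomorphically onto a full lattice in $\mathbb R^s$. The group $U\ltimes\mathcal O_K$ acts on $\mathbb H^s\times\mathbb C^t$: an element $\xi\in\mathcal O_K$ acts by translation by $(\sigma_1(\xi),\dots,\sigma_{s+t}(\xi))$, and $u\in U$ acts by $(z_1,\dots,z_{s+t})\mapsto(\sigma_1(u)z_1,\dots,\sigma_{s+t}(u)z_{s+t})$. Then $X(K,U)=(\mathbb H^s\times\mathbb C^t)/(U\ltimes\mathcal O_K)$. Then, for all choices of $a$, $b_1,\dots,b_n$, $K$, $U$ and $\sigma_{s+1},\dots,\sigma_{s+t}$ as above, the group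 $\pi_1(T_M)$ is not isomorphic to $\pi_1(X(K,U))$, and $T_M$ is not homeomorphic to $X(K,U)$. -/

import Mathlib

open scoped UpperHalfPlane NumberField Matrix

noncomputable section

namespace GenInoue

/-! ## Orbit spaces of groups of homeomorphisms -/

/-- The tautological action of the homeomorphism group of `X` on `X`. -/
instance homeoAction (X : Type*) [TopologicalSpace X] : MulAction (X ≃ₜ X) X where
  smul f x := f x
  one_smul _ := rfl
  mul_smul _ _ _ := rfl

theorem homeo_smul_def {X : Type*} [TopologicalSpace X] (f : X ≃ₜ X) (x : X) : f • x = f x := rfl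

/-- The orbit space `X / G` of a group `G` of homeomorphisms, with the quotient topology. -/
abbrev OrbitSpace {X : Type*} [TopologicalSpace X] (G : Subgroup (X ≃ₜ X)) : Type _ :=
  MulAction.orbitRel.Quotient G X

/-! ## Matrices of type II and the manifold `T_M` -/

/-- `M` viewed as a real matrix. -/
abbrev realMatrix {n : ℕ} (M : Matrix.SpecialLinearGroup (Fin (2 * n + 1)) ℤ) :
    Matrix (Fin (2 * n + 1)) (Fin (2 * n + 1)) ℝ :=
  (M : Matrix (Fin (2 * n + 1)) (Fin (2 * n + 1)) ℤ).map (Int.castRingHom ℝ)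

/-- `M` viewed as a complex matrix. -/
abbrev complexMatrix {n : ℕ} (M : Matrix.SpecialLinearGroup (Fin (2 * n + 1)) ℤ) :
    Matrix (Fin (2 * n + 1)) (Fin (2 * n + 1)) ℂ :=
  (M : Matrix (Fin (2 * n + 1)) (Fin (2 * n + 1)) ℤ).map (Int.castRingHom ℂ)

/-- `M` has exactly one real eigenvalue; it is simple (the multiset of real roots of the
characteristic polynomial is the singleton `{α}`) and irrational. -/
def IsTypeII {n : ℕ} (M : Matrix.SpecialLinearGroup (Fin (2 * n + 1)) ℤ) : Prop :=
  ∃ α : ℝ, Irrational α ∧ (realMatrix M).charpoly.roots = {α}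

/-- Diagonalizability over `ℂ`. -/
def IsDiagonalizable {n : ℕ} (M : Matrix.SpecialLinearGroup (Fin (2 * n + 1)) ℤ) : Prop :=
  ∃ (P : GL (Fin (2 * n + 1)) ℂ) (d : Fin (2 * n + 1) → ℂ),
    complexMatrix M = P.val * Matrix.diagonal d * P⁻¹.val

/-- The endomorphism of `ℂ^{2n+1}` given by `M`. -/
abbrev complexEnd {n : ℕ} (M : Matrix.SpecialLinearGroup (Fin (2 * n + 1)) ℤ) :
    Module.End ℂ (Fin (2 * n + 1) → ℂ) :=
  Matrix.toLin' (complexMatrix M)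

/-- `W`: the sum of the generalized eigenspaces of `M` for the eigenvalues `β` with `Im β > 0`. -/
def W {n : ℕ} (M : Matrix.SpecialLinearGroup (Fin (2 * n + 1)) ℤ) :
    Submodule ℂ (Fin (2 * n + 1) → ℂ) :=
  ⨆ β : {β : ℂ // 0 < β.im}, (complexEnd M).maxGenEigenspace β.1

theorem mapsTo_W_of_commute {n : ℕ} (M : Matrix.SpecialLinearGroup (Fin (2 * n + 1)) ℤ)
    (g : Module.End ℂ (Fin (2 * n + 1) → ℂ)) (hg : Commute (complexEnd M) g) :
    ∀ x ∈ W M, g x ∈ W M := by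
  intro x hx
  have h : W M ≤ (W M).comap g := by
    refine iSup_le fun β y hy => ?_
    exact Submodule.mem_iSup_of_mem β
      (Module.End.mapsTo_maxGenEigenspace_of_comm hg β.1 hy)
  exact h hx

theorem complexEnd_mul_inv {n : ℕ} (M : Matrix.SpecialLinearGroup (Fin (2 * n + 1)) ℤ) :
    complexEnd M * complexEnd M⁻¹ = 1 := by
  rw [complexEnd, complexEnd, Module.End.mul_eq_comp, ← Matrix.toLin'_mul, complexMatrix,
    complexMatrix, ← Matrix.map_mul, ← Matrix.SpecialLinearGroup.coe_mul, mul_inv_cancel]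
  simp [Module.End.one_eq_id]

/-- The restriction `f_M : W → W` of `M`. -/
def restrictW {n : ℕ} (M : Matrix.SpecialLinearGroup (Fin (2 * n + 1)) ℤ) :
    W M →ₗ[ℂ] W M :=
  (complexEnd M).restrict (mapsTo_W_of_commute M _ (Commute.refl _))

/-- The choices made in the construction of `T_M`: a real eigenvector `a` of `M` (with its
eigenvalue `α`) and a basis `b_1, …, b_n` of `W`. -/
structure Frame {n : ℕ} (M : Matrix.SpecialLinearGroup (Fin (2 * n + 1)) ℤ) where
  α : ℝ
  a : Fin (2 * n + 1) → ℝ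
  a_ne_zero : a ≠ 0
  eigen : realMatrix M *ᵥ a = α • a
  b : Module.Basis (Fin n) ℂ (W M)

namespace Frame

variable {n : ℕ} {M : Matrix.SpecialLinearGroup (Fin (2 * n + 1)) ℤ}

/-- The matrix `R` of `f_M` in the basis `b`: `M b_j = ∑ ℓ, R ℓ j • b_ℓ`. -/
def R (F : Frame M) : Matrix (Fin n) (Fin n) ℂ :=
  LinearMap.toMatrix F.b F.b (restrictW M)

theorem isUnit_R (F : Frame M) : IsUnit F.R := by
  have hc : Commute (complexEnd M) (complexEnd M⁻¹) := by
    have h1 := complexEnd_mul_inv M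
    have h2 := complexEnd_mul_inv M⁻¹
    rw [inv_inv] at h2
    exact h1.trans h2.symm
  let g : W M →ₗ[ℂ] W M := (complexEnd M⁻¹).restrict (mapsTo_W_of_commute M _ hc)
  have hfg : restrictW M ∘ₗ g = LinearMap.id := by
    ext1 x
    apply Subtype.ext
    exact LinearMap.congr_fun (complexEnd_mul_inv M) (x : Fin (2 * n + 1) → ℂ)
  have h : F.R * LinearMap.toMatrix F.b F.b g = 1 := by
    rw [R, ← LinearMap.toMatrix_comp, hfg, LinearMap.toMatrix_id]
  exact IsUnit.of_mul_eq_one _ h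

theorem α_pos (F : Frame M) (hM : IsTypeII M) : 0 < F.α := by
  obtain ⟨α', -, hroots⟩ := hM
  have hmonic := (realMatrix M).charpoly_monic
  have key : ∀ x : ℝ, (realMatrix M).charpoly.IsRoot x ↔ x = α' := fun x => by
    rw [← Polynomial.mem_roots hmonic.ne_zero, hroots, Multiset.mem_singleton]
  have hα : F.α = α' := by
    rw [← key, ← Matrix.mem_spectrum_iff_isRoot_charpoly, ← Matrix.spectrum_toLin',
      ← Module.End.hasEigenvalue_iff_mem_spectrum]
    refine Module.End.hasEigenvalue_of_hasEigenvector (x := F.a) ⟨?_, F.a_ne_zero⟩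
    rw [Module.End.mem_eigenspace_iff, Matrix.toLin'_apply, F.eigen]
  have h0 : (realMatrix M).charpoly.eval 0 = -1 := by
    have hdet : (realMatrix M).det = 1 := by
      have h := (Int.castRingHom ℝ).map_det
        (M : Matrix (Fin (2 * n + 1)) (Fin (2 * n + 1)) ℤ)
      rw [M.det_coe, map_one] at h
      exact h.symm
    rw [Matrix.eval_charpoly, map_zero, zero_sub, Matrix.det_neg, hdet]
    simp [pow_succ]
  have hdeg : 0 < (realMatrix M).charpoly.degree := by
    rw [Matrix.charpoly_degree_eq_dim, Fintype.card_fin]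
    exact_mod_cast Nat.succ_pos _
  have ht := Polynomial.tendsto_atTop_of_leadingCoeff_nonneg (realMatrix M).charpoly hdeg
    (by rw [hmonic.leadingCoeff]; exact zero_le_one)
  obtain ⟨y, hy0, hy⟩ := ((Filter.eventually_ge_atTop (0 : ℝ)).and
    (ht.eventually_ge_atTop 0)).exists
  obtain ⟨x, hx, hx0⟩ := intermediate_value_Icc hy0
    ((realMatrix M).charpoly.continuous.continuousOn) (show (0 : ℝ) ∈ _ from ⟨by simp [h0], hy⟩)
  have hxα : x = α' := (key x).1 hx0
  rw [hα, ← hxα]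
  refine lt_of_le_of_ne hx.1 fun h => ?_
  rw [← h] at hx0
  simp only [h0] at hx0
  norm_num at hx0

/-- `g₀(w, z) = (α w, Rᵀ z)`. -/
def g₀ (F : Frame M) (hM : IsTypeII M) : (ℍ × (Fin n → ℂ)) ≃ₜ (ℍ × (Fin n → ℂ)) where
  toFun p := ((⟨F.α, F.α_pos hM⟩ : {x : ℝ // 0 < x}) • p.1, F.Rᵀ *ᵥ p.2)
  invFun p := ((⟨F.α, F.α_pos hM⟩ : {x : ℝ // 0 < x})⁻¹ • p.1, (F.Rᵀ)⁻¹ *ᵥ p.2)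
  left_inv p := by
    have hu : IsUnit (F.Rᵀ).det := by
      rw [Matrix.det_transpose]; exact (Matrix.isUnit_iff_isUnit_det _).1 F.isUnit_R
    ext1
    · exact inv_smul_smul _ _
    · simp [Matrix.mulVec_mulVec, Matrix.nonsing_inv_mul _ hu]
  right_inv p := by
    have hu : IsUnit (F.Rᵀ).det := by
      rw [Matrix.det_transpose]; exact (Matrix.isUnit_iff_isUnit_det _).1 F.isUnit_R
    ext1
    · exact smul_inv_smul _ _
    · simp [Matrix.mulVec_mulVec, Matrix.mul_nonsing_inv _ hu]
  continuous_toFun :=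
    ((UpperHalfPlane.isometry_pos_mul _).continuous.comp continuous_fst).prodMk
      (continuous_const.matrix_mulVec continuous_snd)
  continuous_invFun :=
    ((UpperHalfPlane.isometry_pos_mul _).continuous.comp continuous_fst).prodMk
      (continuous_const.matrix_mulVec continuous_snd)

/-- `g_i(w, z) = (w, z) + u_i` with `u_i = (a^{(i)}, b_1^{(i)}, …, b_n^{(i)})`. -/
def g (F : Frame M) (i : Fin (2 * n + 1)) :
    (ℍ × (Fin n → ℂ)) ≃ₜ (ℍ × (Fin n → ℂ)) where
  toFun p := (F.a i +ᵥ p.1, fun j => p.2 j + (F.b j : Fin (2 * n + 1) → ℂ) i)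
  invFun p := (-F.a i +ᵥ p.1, fun j => p.2 j - (F.b j : Fin (2 * n + 1) → ℂ) i)
  left_inv p := by
    ext1
    · exact neg_vadd_vadd _ _
    · funext j; simp
  right_inv p := by
    ext1
    · exact vadd_neg_vadd _ _
    · funext j; simp
  continuous_toFun :=
    ((UpperHalfPlane.isometry_real_vadd _).continuous.comp continuous_fst).prodMk (by fun_prop)
  continuous_invFun :=
    ((UpperHalfPlane.isometry_real_vadd _).continuous.comp continuous_fst).prodMk (by fun_prop)

/-- The group `G_M` generated by `g₀, g_1, …, g_{2n+1}`. -/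
def group (F : Frame M) (hM : IsTypeII M) :
    Subgroup ((ℍ × (Fin n → ℂ)) ≃ₜ (ℍ × (Fin n → ℂ))) :=
  Subgroup.closure (insert (F.g₀ hM) (Set.range F.g))

/-- (The underlying topological space of) the manifold `T_M = (ℍ × ℂⁿ) / G_M`. -/
abbrev T (F : Frame M) (hM : IsTypeII M) : Type :=
  OrbitSpace (F.group hM)

end Frame

/-! ## Oeljeklaus–Toma manifolds -/

section OT

open NumberField

variable (K : Type*) [Field K] [NumberField K]

/-- The `s` real embeddings of `K`. -/
abbrev RealPlace : Type _ := {w : InfinitePlace K // w.IsReal}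

/-- The `t` conjugate pairs of non-real embeddings of `K`. -/
abbrev ComplexPlace : Type _ := {w : InfinitePlace K // w.IsComplex}

variable {K} in
/-- The real embedding attached to a real place. -/
def realEmb (w : RealPlace K) : K →+* ℝ := InfinitePlace.embedding_of_isReal w.2

/-- The group of units of `𝓞 K` that are positive in every real embedding. -/
def positiveUnits : Subgroup (𝓞 K)ˣ where
  carrier := {u | ∀ w : RealPlace K, 0 < realEmb w (u : 𝓞 K)}
  one_mem' w := by simp
  mul_mem' {u v} hu hv w := by simpa using mul_pos (hu w) (hv w)
  inv_mem' {u} hu w := by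
    have h : realEmb w ((u : 𝓞 K) : K) * realEmb w (((u⁻¹ : (𝓞 K)ˣ) : 𝓞 K) : K) = 1 := by
      rw [← map_mul, ← map_mul, Units.mul_inv, map_one, map_one]
    exact pos_of_mul_pos_right (by rw [h]; exact one_pos) (hu w).le

variable {K}

/-- The logarithmic map `u ↦ (log σ_1(u), …, log σ_s(u))` on positive units. -/
def logReal : Additive (positiveUnits K) →+ (RealPlace K → ℝ) where
  toFun u w := Real.log (realEmb w ((u.toMul : (𝓞 K)ˣ) : 𝓞 K))
  map_zero' := by funext w; simp
  map_add' u v := by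
    funext w
    simpa using Real.log_mul (u.toMul.2 w).ne' (v.toMul.2 w).ne'

/-- The image of `U` in `ℝ^s` under the logarithmic map. -/
def logImage (U : Subgroup (positiveUnits K)) : Submodule ℤ (RealPlace K → ℝ) :=
  AddSubgroup.toIntSubmodule (U.toAddSubgroup.map logReal)

/-- `U` is admissible: the logarithmic map carries `U` isomorphically onto a full lattice in
`ℝ^s`; in particular `U` is free abelian of rank `s`. -/
structure IsAdmissible (U : Subgroup (positiveUnits K)) : Prop where
  injOn : ∀ u ∈ U, logReal (Additive.ofMul u) = 0 → u = 1
  discrete : DiscreteTopology (logImage U)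
  span_eq_top : Submodule.span ℝ (logImage U : Set (RealPlace K → ℝ)) = ⊤

variable (K) in
/-- The space `ℍ^s × ℂ^t`. -/
abbrev OTSpace : Type _ := (RealPlace K → ℍ) × (ComplexPlace K → ℂ)

/-- Translation by `σ(ξ) ∈ ℝ^s × ℂ^t`, where `τ` consists of one embedding from each
conjugate pair of non-real embeddings. -/
def otTranslation (τ : ComplexPlace K → K →+* ℂ) (ξ : 𝓞 K) : OTSpace K ≃ₜ OTSpace K where
  toFun p := (fun w => realEmb w ξ +ᵥ p.1 w, fun w => p.2 w + τ w ξ)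
  invFun p := (fun w => -realEmb w ξ +ᵥ p.1 w, fun w => p.2 w - τ w ξ)
  left_inv p := by
    ext1
    · funext w; exact neg_vadd_vadd _ _
    · funext w; simp
  right_inv p := by
    ext1
    · funext w; exact vadd_neg_vadd _ _
    · funext w; simp
  continuous_toFun := Continuous.prodMk
    (continuous_pi fun w => (UpperHalfPlane.isometry_real_vadd _).continuous.comp
      ((continuous_apply w).comp continuous_fst)) (by fun_prop)
  continuous_invFun := Continuous.prodMk
    (continuous_pi fun w => (UpperHalfPlane.isometry_real_vadd _).continuous.comp
      ((continuous_apply w).comp continuous_fst)) (by fun_prop)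

/-- The positive real number `σ_w(u)`. -/
def posReal (u : positiveUnits K) (w : RealPlace K) : {x : ℝ // 0 < x} :=
  ⟨realEmb w ((u : (𝓞 K)ˣ) : 𝓞 K), u.2 w⟩

/-- `u · (z_1, …, z_{s+t}) = (σ_1(u) z_1, …, σ_{s+t}(u) z_{s+t})`. -/
def otDilation (τ : ComplexPlace K → K →+* ℂ) (u : positiveUnits K) :
    OTSpace K ≃ₜ OTSpace K where
  toFun p := (fun w => posReal u w • p.1 w, fun w => τ w ((u : (𝓞 K)ˣ) : 𝓞 K) * p.2 w)
  invFun p := (fun w => (posReal u w)⁻¹ • p.1 w,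
    fun w => (τ w ((u : (𝓞 K)ˣ) : 𝓞 K))⁻¹ * p.2 w)
  left_inv p := by
    ext1
    · funext w; exact inv_smul_smul _ _
    · funext w; simp
  right_inv p := by
    ext1
    · funext w; exact smul_inv_smul _ _
    · funext w; simp
  continuous_toFun := Continuous.prodMk
    (continuous_pi fun w => (UpperHalfPlane.isometry_pos_mul _).continuous.comp
      ((continuous_apply w).comp continuous_fst)) (by fun_prop)
  continuous_invFun := Continuous.prodMk
    (continuous_pi fun w => (UpperHalfPlane.isometry_pos_mul _).continuous.comp
      ((continuous_apply w).comp continuous_fst)) (by fun_prop)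

/-- Multiplication of `U` on `𝓞 K` by group automorphisms. -/
def otMul (U : Subgroup (positiveUnits K)) : U →* MulAut (Multiplicative (𝓞 K)) where
  toFun u := AddEquiv.toMultiplicative
    (DistribMulAction.toAddEquiv (𝓞 K) ((u : positiveUnits K) : (𝓞 K)ˣ))
  map_one' := by ext x; simp
  map_mul' u v := by
    refine MulEquiv.ext fun x => ?_
    exact congrArg (fun y : 𝓞 K => Multiplicative.ofAdd y) (mul_smul
      ((u : positiveUnits K) : (𝓞 K)ˣ) ((v : positiveUnits K) : (𝓞 K)ˣ) x.toAdd)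

/-- The action of the semidirect product `U ⋉ 𝓞 K` on `ℍ^s × ℂ^t`: `𝓞 K` acts by translations,
`U` by coordinatewise multiplication. -/
def otAction (τ : ComplexPlace K → K →+* ℂ) (U : Subgroup (positiveUnits K)) :
    Multiplicative (𝓞 K) ⋊[otMul U] U →* (OTSpace K ≃ₜ OTSpace K) :=
  SemidirectProduct.lift
    { toFun := fun ξ => otTranslation τ ξ.toAdd
      map_one' := by
        ext1 p
        ext1
        · funext w; simp [otTranslation]
        · funext w; simp [otTranslation]
      map_mul' := fun ξ η => by
        ext1 p
        ext1
        · funext w; simp [otTranslation, add_vadd]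
        · funext w; simp [otTranslation]; ring }
    { toFun := fun u => otDilation τ u
      map_one' := by
        ext1 p
        ext1
        · funext w
          have : posReal (1 : positiveUnits K) w = 1 := Subtype.ext (by simp [posReal])
          simp [otDilation, this]
        · funext w; simp [otDilation]
      map_mul' := fun u v => by
        ext1 p
        ext1
        · funext w
          have : posReal (u.1 * v.1) w = posReal u.1 w * posReal v.1 w :=
            Subtype.ext (by simp [posReal])
          simp [otDilation, this, mul_smul]
        · funext w; simp [otDilation]; ring }
    (by
      intro u
      refine MonoidHom.ext fun ξ => ?_
      simp only [MonoidHom.comp_apply, MulEquiv.coe_toMonoidHom, MulAut.conj_apply]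
      rw [eq_mul_inv_iff_mul_eq]
      ext1 p
      ext1
      · funext w
        apply UpperHalfPlane.ext
        simp [otMul, otTranslation, otDilation, posReal, Units.smul_def, mul_add]
      · funext w
        simp [otMul, otTranslation, otDilation, Units.smul_def]; ring)

/-- (The underlying topological space of) the Oeljeklaus–Toma manifold
`X(K, U) = (ℍ^s × ℂ^t) / (U ⋉ 𝓞 K)`. -/
abbrev OTManifold (τ : ComplexPlace K → K →+* ℂ) (U : Subgroup (positiveUnits K)) : Type _ :=
  OrbitSpace (otAction τ U).range

end OT

end GenInoue

end

/-!
Both `ℍ × ℂⁿ` and `ℍ^s × ℂ^t` are contractible and the groups act on them as deck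
transformations, so the fundamental groups are `G_M` and `U ⋉ 𝓞 K`. In `G_M`, conjugation by `g₀`
acts on the lattice `ℤ^{2n+1}` of translations as `Mᵀ`, and `Mᵀ - 1` is injective because the only
real eigenvalue of `M` is irrational. As `U` is commutative, an embedding of `G_M` into `U ⋉ 𝓞 K`
sends commutators into `𝓞 K`; precomposing with `Mᵀ - 1` therefore embeds the lattice into `𝓞 K`,
so that `Mᵀ` becomes multiplication by a unit `u ∈ U`. The minimal polynomial of `u` is separable
and annihilates `M`, which forces `M` to be diagonalizable.
-/

noncomputable section

namespace GenInoue

/-! ## Squarefree annihilating polynomials and diagonalizability -/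

theorem exists_basis_forall_apply_eq_smul {k V ι : Type*} [Field k] [AddCommGroup V] [Module k V]
    (b₀ : Module.Basis ι k V) {f : Module.End k V} (hf : ⨆ μ, f.eigenspace μ = ⊤) :
    ∃ (b : Module.Basis ι k V) (d : ι → k), ∀ i, f (b i) = d i • b i := by
  have hspan : ⊤ ≤ Submodule.span k {x | ∃ μ : k, f x = μ • x} := by
    rw [← hf]
    exact iSup_le fun μ x hx =>
      Submodule.subset_span ⟨μ, Module.End.mem_eigenspace_iff.1 hx⟩
  let b := Module.Basis.ofSpan hspan
  have hb (i) : ∃ μ : k, f (b i) = μ • b i := Module.Basis.ofSpan_subset hspan ⟨i, rfl⟩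
  choose d hd using hb
  let e := b.indexEquiv b₀
  exact ⟨b.reindex e, d ∘ e.symm, fun i => by simpa using hd (e.symm i)⟩

theorem exists_eq_mul_diagonal_mul_inv {k ι : Type*} [Field k] [IsAlgClosed k] [Fintype ι]
    [DecidableEq ι] {A : Matrix ι ι k} {p : Polynomial k} (hp : Squarefree p)
    (hA : Polynomial.aeval A p = 0) :
    ∃ (P : GL ι k) (d : ι → k), A = P.val * Matrix.diagonal d * P⁻¹.val := by
  have hf : Polynomial.aeval (Matrix.toLin' A) p = 0 := by
    have := Polynomial.aeval_algHom_apply (Matrix.toLinAlgEquiv' (R := k) (n := ι)) A p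
    rwa [hA, map_zero] at this
  obtain ⟨b, d, hd⟩ := exists_basis_forall_apply_eq_smul (Pi.basisFun k ι)
    (Module.End.isSemisimple_of_squarefree_aeval_eq_zero hp hf).iSup_eigenspace_eq_top
  let P : GL ι k := ⟨(Pi.basisFun k ι).toMatrix b, b.toMatrix (Pi.basisFun k ι),
    Module.Basis.toMatrix_mul_toMatrix_flip _ _, Module.Basis.toMatrix_mul_toMatrix_flip _ _⟩
  have key : A * P.val = P.val * Matrix.diagonal d := by
    ext i j
    rw [Matrix.mul_diagonal]
    simpa [P, Matrix.mul_apply, Module.Basis.toMatrix_apply, Matrix.mulVec, dotProduct,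
      mul_comm] using congrFun (hd j) i
  exact ⟨P, d, by rw [← key, mul_assoc, Units.mul_inv, mul_one]⟩

theorem aeval_transpose {R S ι : Type*} [CommSemiring R] [CommSemiring S] [Algebra R S]
    [Fintype ι] [DecidableEq ι] (A : Matrix ι ι S) (p : Polynomial R) :
    Polynomial.aeval Aᵀ p = (Polynomial.aeval A p)ᵀ := by
  have h := Polynomial.aeval_algHom_apply (Matrix.transposeAlgEquiv ι R S) A p
  simpa [Polynomial.aeval_op_apply] using congrArg MulOpposite.unop h

theorem aeval_comp_of_comp_eq {R V W : Type*} [CommSemiring R] [AddCommMonoid V]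
    [AddCommMonoid W] [Module R V] [Module R W] {f : V →ₗ[R] W} {g : Module.End R V}
    {h : Module.End R W} (hfg : h ∘ₗ f = f ∘ₗ g) (p : Polynomial R) :
    Polynomial.aeval h p ∘ₗ f = f ∘ₗ Polynomial.aeval g p := by
  induction p using Polynomial.induction_on' with
  | add p q hp hq => simp only [map_add, LinearMap.add_comp, LinearMap.comp_add, hp, hq]
  | monomial k c =>
    ext v
    have hk : (h ^ k) (f v) = f ((g ^ k) v) :=
      LinearMap.congr_fun (Module.End.commute_pow_left_of_commute hfg k) v
    simp [Polynomial.aeval_monomial, hk]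

theorem isDiagonalizable_of_aeval_eq_zero {n : ℕ}
    {M : Matrix.SpecialLinearGroup (Fin (2 * n + 1)) ℤ} {p : Polynomial ℤ}
    (hp : Squarefree (p.map (Int.castRingHom ℂ)))
    (hM : Polynomial.aeval (M : Matrix (Fin (2 * n + 1)) (Fin (2 * n + 1)) ℤ) p = 0) :
    IsDiagonalizable M := by
  refine exists_eq_mul_diagonal_mul_inv hp ?_
  have h := Polynomial.aeval_algHom_apply (Int.castRingHom ℂ).mapMatrix.toIntAlgHom
    (M : Matrix (Fin (2 * n + 1)) (Fin (2 * n + 1)) ℤ) p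
  rw [hM, map_zero] at h
  rw [← algebraMap_int_eq, Polynomial.aeval_map_algebraMap]
  exact h

/-! ## Embeddings into semidirect products -/

section SemidirectProduct

theorem conj_left_of_right_eq_one {N H : Type*} [CommGroup N] [Group H] {ρ : H →* MulAut N}
    (x : N ⋊[ρ] H) {y : N ⋊[ρ] H} (hy : y.right = 1) :
    (x * y * x⁻¹).left = ρ x.right y.left := by
  simp [hy, mul_comm x.left]

/-- Conjugation by `x` induces `f` on `L`, so `h ((f - 1) v)` is the commutator of `x` and `h v`:
as `H` is commutative, `h` maps the image of `f - 1` into `N`. -/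
theorem exists_injective_intertwining {L N H : Type*} [AddCommGroup L] [AddCommGroup N]
    [CommGroup H] {ρ : H →* MulAut (Multiplicative N)}
    {h : Multiplicative L →* Multiplicative N ⋊[ρ] H} (hh : Function.Injective h)
    {f : Module.End ℤ L} (hf : Function.Injective ⇑(f - 1)) {x : Multiplicative N ⋊[ρ] H}
    (hx : ∀ v : L, x * h (.ofAdd v) * x⁻¹ = h (.ofAdd (f v))) :
    ∃ ψ : L →ₗ[ℤ] N, Function.Injective ψ ∧
      ∀ v, ψ (f v) = (ρ x.right (.ofAdd (ψ v))).toAdd := by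
  let c : Multiplicative L →* Multiplicative N ⋊[ρ] H :=
    h.comp (f - 1).toAddMonoidHom.toMultiplicative
  have hc_apply (v : L) : c (.ofAdd v) = h (.ofAdd (f v)) * (h (.ofAdd v))⁻¹ := by
    rw [← map_inv, ← map_mul, ← ofAdd_neg, ← ofAdd_add, ← sub_eq_add_neg]
    rfl
  have hc_right (v : L) : (c (.ofAdd v)).right = 1 := by
    rw [hc_apply, ← hx]
    simp
  have hc_conj (v : L) : c (.ofAdd (f v)) = x * c (.ofAdd v) * x⁻¹ := by
    simp only [hc_apply, ← hx]
    group
  let ψ : L →+ N := AddMonoidHom.mk' (fun v => (c (.ofAdd v)).left.toAdd) fun v w => by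
    simp [hc_right]
  refine ⟨ψ.toIntLinearMap, (injective_iff_map_eq_zero ψ).2 fun v hv => ?_, fun v => ?_⟩
  · have hcv : h (.ofAdd ((f - 1) v)) = 1 := SemidirectProduct.ext hv (hc_right v)
    exact (map_eq_zero_iff _ hf).1 ((map_eq_one_iff _ hh).1 hcv)
  · change (c (.ofAdd (f v))).left.toAdd = _
    rw [hc_conj, conj_left_of_right_eq_one x (hc_right v)]
    rfl

end SemidirectProduct

section NumberField

variable {K : Type*} [Field K]

theorem exists_aeval_minpoly_eq_zero {L : Type*} [AddCommGroup L]
    {U : Subgroup (positiveUnits K)} {h : Multiplicative L →* Multiplicative (𝓞 K) ⋊[otMul U] U}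
    (hh : Function.Injective h) {f : Module.End ℤ L} (hf : Function.Injective ⇑(f - 1))
    {x : Multiplicative (𝓞 K) ⋊[otMul U] U}
    (hx : ∀ v : L, x * h (.ofAdd v) * x⁻¹ = h (.ofAdd (f v))) :
    ∃ u : 𝓞 K, Polynomial.aeval f (minpoly ℤ u) = 0 := by
  obtain ⟨ψ, hψ, hψf⟩ := exists_injective_intertwining hh hf hx
  let u : 𝓞 K := ((x.right : positiveUnits K) : (𝓞 K)ˣ)
  have hcomp : Algebra.lmul ℤ (𝓞 K) u ∘ₗ ψ = ψ ∘ₗ f := LinearMap.ext fun v => (hψf v).symm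
  refine ⟨u, LinearMap.ext fun v => hψ ?_⟩
  have h0 := LinearMap.congr_fun (aeval_comp_of_comp_eq hcomp (minpoly ℤ u)) v
  rw [Polynomial.aeval_algHom_apply, minpoly.aeval, map_zero] at h0
  rw [LinearMap.zero_apply, map_zero]
  exact h0.symm

theorem separable_map_minpoly [CharZero K] (F : Type*) [Field F] [CharZero F] (u : 𝓞 K) :
    ((minpoly ℤ u).map (Int.castRingHom F)).Separable := by
  have hu : IsIntegral ℤ u := Algebra.IsIntegral.isIntegral u
  have hsep : ((minpoly ℤ u).map (algebraMap ℤ ℚ)).Separable := by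
    rw [← minpoly.isIntegrallyClosed_eq_field_fractions ℚ K hu]
    exact (minpoly.irreducible (hu.map (algebraMap (𝓞 K) K).toIntAlgHom).tower_top).separable
  simpa [Polynomial.map_map, RingHom.eq_intCast'] using hsep.map (f := Rat.castHom F)

end NumberField

/-! ## Fundamental groups of orbit spaces -/

section FundamentalGroup

open Topology

theorem isQuotientCoveringMap_orbitSpace {X Y : Type*} [TopologicalSpace X] [PseudoMetricSpace Y]
    {G : Subgroup (X ≃ₜ X)} {c : X → Y} (hc : Continuous c) {ε : ℝ} (hε : 0 < ε)
    (hG : ∀ f ∈ G, ∀ p, dist (c (f p)) (c p) < ε → f = 1) :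
    IsQuotientCoveringMap (Quotient.mk (MulAction.orbitRel G X)) G where
  toIsQuotientMap := isQuotientMap_quotient_mk'
  continuous_const_smul g := (g : X ≃ₜ X).continuous
  apply_eq_iff_mem_orbit := Quotient.eq''
  disjoint p₀ := by
    refine ⟨c ⁻¹' Metric.ball (c p₀) (ε / 2),
      hc.continuousAt.preimage_mem_nhds (Metric.ball_mem_nhds _ (half_pos hε)), ?_⟩
    rintro g ⟨_, ⟨p, hp, rfl⟩, hgp⟩
    refine Subtype.ext (hG g g.2 p ?_)
    calc dist (c (g • p)) (c p) ≤ dist (c (g • p)) (c p₀) + dist (c p) (c p₀) :=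
          dist_triangle_right _ _ _
      _ < ε / 2 + ε / 2 := add_lt_add hgp hp
      _ = ε := add_halves ε

theorem nonempty_fundamentalGroup_mulEquiv {X Y G : Type*} [TopologicalSpace X]
    [SimplyConnectedSpace X] [TopologicalSpace Y] [Group G] [MulAction G X] {q : X → Y}
    (hq : IsQuotientCoveringMap q G) (y : Y) : Nonempty (FundamentalGroup Y y ≃* G) := by
  obtain ⟨p, rfl⟩ := hq.surjective y
  exact ⟨(hq.fundamentalGroupEquiv ⟨p, rfl⟩).trans (MulEquiv.inv' G).symm⟩

theorem fundamentalGroup_map_injective {X Y : Type*} [TopologicalSpace X] [TopologicalSpace Y]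
    (e : ContinuousMap.HomotopyEquiv X Y) (x : X) :
    Function.Injective (FundamentalGroup.map e.toFun x) :=
  (FundamentalGroupoidFunctor.equivOfHomotopyEquiv e).functor.map_injective

theorem contractibleSpace_pi {ι : Type*} {Y : ι → Type*} [∀ i, TopologicalSpace (Y i)]
    [∀ i, ContractibleSpace (Y i)] : ContractibleSpace (∀ i, Y i) :=
  ⟨⟨(ContinuousMap.HomotopyEquiv.piCongrRight fun i =>
    (ContractibleSpace.hequiv_unit' (X := Y i)).some).trans
      (Homeomorph.homeomorphOfUnique (ι → Unit) Unit).toHomotopyEquiv⟩⟩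

end FundamentalGroup

/-! ## The group `G_M` -/

theorem exists_eq_mul_zpow_of_mem_sup {L G : Type*} [Group L] [Group G] {h : L →* G} {g : G}
    {f : L → L} (hf : Function.Surjective f) (hg : ∀ v, g * h v * g⁻¹ = h (f v)) {x : G}
    (hx : x ∈ h.range ⊔ Subgroup.zpowers g) : ∃ (v : L) (k : ℤ), x = h v * g ^ k := by
  have hnormal : Subgroup.zpowers g ≤ Subgroup.normalizer (h.range : Set G) := by
    rw [Subgroup.zpowers_le, Subgroup.mem_normalizer_iff]
    refine fun y => ⟨?_, ?_⟩
    · rintro ⟨v, rfl⟩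
      exact ⟨f v, (hg v).symm⟩
    · rintro ⟨w, hw⟩
      obtain ⟨v, rfl⟩ := hf w
      rw [← hg] at hw
      exact ⟨v, mul_left_cancel (mul_right_cancel hw)⟩
  rw [← SetLike.mem_coe, Subgroup.coe_mul_of_right_le_normalizer_left _ _ hnormal] at hx
  obtain ⟨_, ⟨v, rfl⟩, _, ⟨k, rfl⟩, rfl⟩ := hx
  exact ⟨v, k, rfl⟩

theorem coordinate_zpow_apply {X Y : Type*} [TopologicalSpace X] [AddCommGroup Y] {c : X → Y}
    {f : X ≃ₜ X} {a : Y} (hf : ∀ p, c (f p) = a + c p) (k : ℤ) (p : X) :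
    c ((f ^ k) p) = k • a + c p := by
  induction k generalizing p with
  | zero => simp
  | succ k ih =>
    rw [zpow_add_one, Homeomorph.mul_apply, ih, hf, add_smul, one_smul, add_assoc]
  | pred k ih =>
    have hinv : c (f⁻¹ p) = -a + c p := by
      rw [eq_neg_add_iff_add_eq, ← hf, ← Homeomorph.mul_apply, mul_inv_cancel, Homeomorph.one_apply]
    rw [zpow_sub_one, Homeomorph.mul_apply, ih, hinv, sub_smul, one_smul, sub_eq_add_neg, add_assoc]

section ComplexConjugation

variable {V : Type*} [AddCommGroup V] [Module ℂ V] [StarAddMonoid V] [StarModule ℂ V]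
  {f : Module.End ℂ V}

theorem star_mem_maxGenEigenspace (hf : ∀ x, f (star x) = star (f x)) {β : ℂ} {x : V}
    (hx : x ∈ f.maxGenEigenspace β) : star x ∈ f.maxGenEigenspace (star β) := by
  rw [Module.End.mem_maxGenEigenspace] at hx ⊢
  have hpow (k : ℕ) (y : V) : ((f - star β • 1) ^ k) (star y) = star (((f - β • 1) ^ k) y) := by
    induction k with
    | zero => rfl
    | succ k ih =>
      rw [pow_succ', pow_succ', Module.End.mul_apply, ih]
      simp [hf, star_smul]
  exact hx.imp fun k hk => by rw [hpow, hk, star_zero]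

theorem eq_zero_of_maxGenEigenspace_le_ker [FiniteDimensional ℂ V]
    (hf : ∀ x, f (star x) = star (f x)) {ℓ : Module.Dual ℂ V} (hℓ : ∀ x, ℓ (star x) = star (ℓ x))
    (h : ∀ β : ℂ, 0 ≤ β.im → f.maxGenEigenspace β ≤ LinearMap.ker ℓ) : ℓ = 0 := by
  rw [← LinearMap.ker_eq_top, eq_top_iff, ← Module.End.iSup_maxGenEigenspace_eq_top f]
  refine iSup_le fun β x hx => ?_
  rcases le_total 0 β.im with hβ | hβ
  · exact h β hβ hx
  · have hstar : ℓ (star x) = 0 :=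
      h (star β) (by simpa using hβ) (star_mem_maxGenEigenspace hf hx)
    rwa [hℓ, star_eq_zero] at hstar

end ComplexConjugation

theorem finrank_maxGenEigenspace_ofReal {ι : Type*} [Fintype ι] [DecidableEq ι]
    (A : Matrix ι ι ℝ) (r : ℝ) :
    Module.finrank ℂ (Module.End.maxGenEigenspace (Matrix.toLin' (A.map Complex.ofRealHom)) r) =
      A.charpoly.roots.count r := by
  rw [LinearMap.finrank_maxGenEigenspace_eq, Polynomial.count_roots, Matrix.charpoly_toLin',
    Matrix.charpoly_map]
  exact (Polynomial.eq_rootMultiplicity_map Complex.ofRealHom.injective r).symm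

theorem exists_pos_forall_norm_linearCombination_lt {ι E : Type*} [Fintype ι]
    [NormedAddCommGroup E] [NormedSpace ℝ E] {u : ι → E} (hu : LinearIndependent ℝ u) :
    ∃ ε > 0, ∀ v : ι → ℤ, ‖Fintype.linearCombination ℤ u v‖ < ε → v = 0 := by
  obtain ⟨C, hC, hlip⟩ := (Fintype.linearCombination ℝ u).injective_iff_antilipschitz.1
    hu.fintypeLinearCombination_injective
  have hC' : (0 : ℝ) < C := hC
  refine ⟨(C : ℝ)⁻¹, inv_pos.2 hC', fun v hv => funext fun i => ?_⟩
  have hcast : Fintype.linearCombination ℤ u v =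
      Fintype.linearCombination ℝ u (fun i => (v i : ℝ)) := by
    simp [Fintype.linearCombination_apply, Int.cast_smul_eq_zsmul]
  have hlt : |(v i : ℝ)| < 1 := by
    calc |(v i : ℝ)| ≤ ‖fun i => (v i : ℝ)‖ := norm_le_pi_norm (fun i => (v i : ℝ)) i
      _ ≤ C * ‖Fintype.linearCombination ℤ u v‖ := by
        rw [hcast]
        simpa using hlip.le_mul_dist (fun i => (v i : ℝ)) 0
      _ < C * (C : ℝ)⁻¹ := by gcongr
      _ = 1 := mul_inv_cancel₀ hC'.ne'
  exact Int.abs_lt_one_iff.1 (by exact_mod_cast hlt)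

namespace Frame

variable {n : ℕ} {M : Matrix.SpecialLinearGroup (Fin (2 * n + 1)) ℤ}

theorem roots_charpoly (F : Frame M) (hM : IsTypeII M) :
    (realMatrix M).charpoly.roots = {F.α} := by
  obtain ⟨β, -, hroots⟩ := hM
  have hα : F.α ∈ (realMatrix M).charpoly.roots := by
    rw [Polynomial.mem_roots (realMatrix M).charpoly_monic.ne_zero,
      ← Matrix.mem_spectrum_iff_isRoot_charpoly, ← Matrix.spectrum_toLin',
      ← Module.End.hasEigenvalue_iff_mem_spectrum]
    exact Module.End.hasEigenvalue_of_hasEigenvector (x := F.a)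
      ⟨Module.End.mem_eigenspace_iff.2 F.eigen, F.a_ne_zero⟩
  rw [hroots, Multiset.mem_singleton] at hα
  rw [hroots, hα]

theorem α_ne_one (F : Frame M) (hM : IsTypeII M) : F.α ≠ 1 := by
  have hroots := F.roots_charpoly hM
  obtain ⟨β, hβ, hβroots⟩ := hM
  rw [Multiset.singleton_inj.1 (hroots.symm.trans hβroots)]
  exact hβ.ne_one

theorem det_transpose_sub_one_ne_zero (F : Frame M) (hM : IsTypeII M) :
    ((M : Matrix (Fin (2 * n + 1)) (Fin (2 * n + 1)) ℤ)ᵀ - 1).det ≠ 0 := by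
  intro h
  have hroot : (realMatrix M).charpoly.eval 1 = 0 := by
    have hdet := congrArg (Int.castRingHom ℝ) h
    rw [RingHom.map_det, map_zero, map_sub, map_one] at hdet
    rw [Matrix.eval_charpoly, map_one, ← neg_sub, Matrix.det_neg, ← Matrix.det_transpose,
      Matrix.transpose_sub, Matrix.transpose_one]
    exact mul_eq_zero_of_right _ hdet
  have hmem : (1 : ℝ) ∈ (realMatrix M).charpoly.roots :=
    (Polynomial.mem_roots (realMatrix M).charpoly_monic.ne_zero).2 hroot
  rw [F.roots_charpoly hM, Multiset.mem_singleton] at hmem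
  exact F.α_ne_one hM hmem.symm

theorem maxGenEigenspace_ofReal_le_span (F : Frame M) (hM : IsTypeII M) (r : ℝ) :
    (complexEnd M).maxGenEigenspace (r : ℂ) ≤ Submodule.span ℂ {fun i => (F.a i : ℂ)} := by
  have hfin : Module.finrank ℂ ((complexEnd M).maxGenEigenspace (r : ℂ)) =
      if r = F.α then 1 else 0 := by
    have hmap : complexMatrix M = (realMatrix M).map Complex.ofRealHom := by
      ext i j
      simp
    rw [complexEnd, hmap, finrank_maxGenEigenspace_ofReal, F.roots_charpoly hM,
      Multiset.count_singleton]
  have ha : (fun i => (F.a i : ℂ)) ∈ (complexEnd M).maxGenEigenspace (F.α : ℂ) := by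
    refine (Module.End.genEigenspace _ _).mono le_top (Module.End.mem_eigenspace_iff.2 ?_)
    ext i
    simpa [Matrix.mulVec, dotProduct] using congrArg Complex.ofReal (congrFun F.eigen i)
  have ha0 : (fun i => (F.a i : ℂ)) ≠ 0 := fun h =>
    F.a_ne_zero (funext fun i => Complex.ofReal_eq_zero.1 (congrFun h i))
  split_ifs at hfin with hr
  · subst hr
    refine (Submodule.eq_of_le_of_finrank_eq
      ((Submodule.span_singleton_le_iff_mem _ _).2 ha) ?_).ge
    rw [finrank_span_singleton ha0, hfin]
  · rw [Submodule.finrank_eq_zero.1 hfin]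
    exact bot_le

/-- The vector `u_i = (a^{(i)}, b_1^{(i)}, …, b_n^{(i)})` by which `g_i` translates. -/
def periodVector (F : Frame M) (i : Fin (2 * n + 1)) : ℝ × (Fin n → ℂ) :=
  (F.a i, fun j => (F.b j : Fin (2 * n + 1) → ℂ) i)

theorem linearIndependent_periodVector (F : Frame M) (hM : IsTypeII M) :
    LinearIndependent ℝ F.periodVector := by
  refine Fintype.linearIndependent_iff.2 fun v hv i => ?_
  let ℓ : Module.Dual ℂ (Fin (2 * n + 1) → ℂ) := dotProductBilin ℂ ℂ fun i => (v i : ℂ)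
  have hℓ_apply (x) : ℓ x = ∑ i, (v i : ℂ) * x i := rfl
  have hℓa : ℓ (fun i => (F.a i : ℂ)) = 0 := by
    have := congrArg (fun q => (q.1 : ℂ)) hv
    simpa [hℓ_apply, periodVector, Prod.fst_sum] using this
  have hℓb (j) : ℓ (F.b j) = 0 := by
    have := congrArg (fun q => q.2 j) hv
    simpa [hℓ_apply, periodVector, Prod.snd_sum] using this
  have hℓW : W M ≤ LinearMap.ker ℓ := by
    have : ℓ ∘ₗ (W M).subtype = 0 := F.b.ext hℓb
    exact fun x hx => LinearMap.congr_fun this ⟨x, hx⟩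
  have hℓ : ℓ = 0 := by
    refine eq_zero_of_maxGenEigenspace_le_ker (f := complexEnd M) ?_ ?_ fun β hβ => ?_
    · intro x; ext i; simp [Matrix.mulVec, dotProduct]
    · intro x; simp [hℓ_apply]
    · rcases hβ.eq_or_lt with hβ | hβ
      · lift β to ℝ using hβ.symm
        exact (F.maxGenEigenspace_ofReal_le_span hM β).trans
          ((Submodule.span_singleton_le_iff_mem _ _).2 hℓa)
      · exact (le_iSup (fun β : {β : ℂ // 0 < β.im} => (complexEnd M).maxGenEigenspace β.1)
          ⟨β, hβ⟩).trans hℓW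
  simpa [hℓ_apply, Pi.single_apply] using LinearMap.congr_fun hℓ (Pi.single i 1)

theorem injective_transpose_sub_one (F : Frame M) (hM : IsTypeII M) :
    Function.Injective ⇑(Matrix.toLin' (M : Matrix (Fin (2 * n + 1)) (Fin (2 * n + 1)) ℤ)ᵀ - 1) :=
  (injective_iff_map_eq_zero _).2 fun v hv => Matrix.eq_zero_of_mulVec_eq_zero
    (F.det_transpose_sub_one_ne_zero hM) (by simpa [Matrix.sub_mulVec] using hv)

/-- The homomorphism `ℤ^{2n+1} → ℝ × ℂⁿ` with `e_i ↦ u_i`, parametrizing the lattice of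
translations in `G_M`. -/
def period (F : Frame M) : (Fin (2 * n + 1) → ℤ) →ₗ[ℤ] ℝ × (Fin n → ℂ) :=
  Fintype.linearCombination ℤ F.periodVector

/-- The map `(w, z) ↦ (α w, Rᵀ z)` on translation vectors. -/
def dilation (F : Frame M) : Module.End ℝ (ℝ × (Fin n → ℂ)) :=
  (LinearMap.lsmul ℝ ℝ F.α).prodMap ((Matrix.toLin' F.Rᵀ).restrictScalars ℝ)

theorem dilation_apply (F : Frame M) (q : ℝ × (Fin n → ℂ)) :
    F.dilation q = (F.α * q.1, F.Rᵀ *ᵥ q.2) := rfl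

theorem mulVec_b (F : Frame M) (j : Fin n) :
    complexMatrix M *ᵥ (F.b j : Fin (2 * n + 1) → ℂ) =
      ∑ l, F.R l j • (F.b l : Fin (2 * n + 1) → ℂ) := by
  have h := congrArg (W M).subtype (F.b.sum_repr (restrictW M (F.b j)))
  rw [map_sum] at h
  simpa [R, LinearMap.toMatrix_apply, restrictW] using h.symm

theorem sum_smul_periodVector (F : Frame M) (i : Fin (2 * n + 1)) :
    ∑ j, M i j • F.periodVector j = F.dilation (F.periodVector i) := by
  refine Prod.ext ?_ (funext fun l => ?_)
  · simpa [dilation_apply, periodVector, Prod.fst_sum, Matrix.mulVec, dotProduct] using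
      congrFun F.eigen i
  · simpa [dilation_apply, periodVector, Prod.snd_sum, Matrix.mulVec, dotProduct] using
      congrFun (F.mulVec_b l) i

theorem period_transpose_mulVec (F : Frame M) (v : Fin (2 * n + 1) → ℤ) :
    F.period ((M : Matrix (Fin (2 * n + 1)) (Fin (2 * n + 1)) ℤ)ᵀ *ᵥ v) =
      F.dilation (F.period v) := by
  simp only [period, Fintype.linearCombination_apply, map_sum, map_zsmul, ← sum_smul_periodVector,
    Matrix.mulVec, dotProduct, Matrix.transpose_apply, Finset.sum_smul, Finset.smul_sum]
  rw [Finset.sum_comm]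
  simp only [mul_comm, mul_smul]

end Frame

instance continuousConstVAdd_upperHalfPlane : ContinuousConstVAdd ℝ ℍ :=
  ⟨fun x => (UpperHalfPlane.isometry_real_vadd x).continuous⟩

/-- The action of `ℝ × ℂⁿ` on `ℍ × ℂⁿ` by translations. -/
def translation (n : ℕ) :
    Multiplicative (ℝ × (Fin n → ℂ)) →* ((ℍ × (Fin n → ℂ)) ≃ₜ (ℍ × (Fin n → ℂ))) where
  toFun q := (Homeomorph.vadd q.toAdd.1 : ℍ ≃ₜ ℍ).prodCongr (Homeomorph.addLeft q.toAdd.2)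
  map_one' := by
    ext1 p
    simp [Prod.ext_iff]
  map_mul' q r := by
    ext1 p
    simp [Prod.ext_iff, add_vadd, add_assoc]

theorem translation_apply {n : ℕ} (q : ℝ × (Fin n → ℂ)) (p : ℍ × (Fin n → ℂ)) :
    translation n (.ofAdd q) p = (q.1 +ᵥ p.1, q.2 + p.2) := by
  simp [translation, Prod.ext_iff]

theorem translation_injective (n : ℕ) : Function.Injective (translation n) := by
  refine (injective_iff_map_eq_one _).2 fun q hq => ?_
  have h := DFunLike.congr_fun hq ((UpperHalfPlane.I, 0) : ℍ × (Fin n → ℂ))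
  rw [← ofAdd_toAdd q, translation_apply] at h
  refine Multiplicative.toAdd.injective (Prod.ext ?_ ?_)
  · simpa using congrArg (fun p => p.1.re) h
  · simpa using congrArg Prod.snd h

/-- The coordinates `(log Im w, Re w, z)` on `ℍ × ℂⁿ`: in the first of them `G_M` acts by
translations, the kernel of that action being the lattice, which translates the others. -/
def coord {n : ℕ} (p : ℍ × (Fin n → ℂ)) : ℝ × ℝ × (Fin n → ℂ) :=
  (Real.log p.1.im, p.1.re, p.2)

theorem continuous_coord {n : ℕ} : Continuous (coord : ℍ × (Fin n → ℂ) → ℝ × ℝ × (Fin n → ℂ)) :=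
  ((UpperHalfPlane.continuous_im.comp continuous_fst).log fun p => p.1.im_ne_zero).prodMk
    ((UpperHalfPlane.continuous_re.comp continuous_fst).prodMk continuous_snd)

theorem coord_translation {n : ℕ} (q : ℝ × (Fin n → ℂ)) (p : ℍ × (Fin n → ℂ)) :
    coord (translation n (.ofAdd q) p) = (0, q) + coord p := by
  simp [coord, translation_apply, Prod.ext_iff]

namespace Frame

variable {n : ℕ} {M : Matrix.SpecialLinearGroup (Fin (2 * n + 1)) ℤ}

theorem g₀_conj_translation (F : Frame M) (hM : IsTypeII M) (q : ℝ × (Fin n → ℂ)) :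
    F.g₀ hM * translation n (.ofAdd q) * (F.g₀ hM)⁻¹ = translation n (.ofAdd (F.dilation q)) := by
  rw [mul_inv_eq_iff_eq_mul]
  ext1 p
  refine Prod.ext (UpperHalfPlane.ext ?_) ?_
  · simp [translation_apply, dilation_apply, g₀]
  · simp [translation_apply, dilation_apply, g₀, Matrix.mulVec_add]

/-- The homomorphism from `ℤ^{2n+1}` to `G_M` with `e_i ↦ g_i`. -/
def latticeTranslation (F : Frame M) :
    Multiplicative (Fin (2 * n + 1) → ℤ) →* ((ℍ × (Fin n → ℂ)) ≃ₜ (ℍ × (Fin n → ℂ))) :=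
  (translation n).comp F.period.toAddMonoidHom.toMultiplicative

theorem latticeTranslation_ofAdd (F : Frame M) (v : Fin (2 * n + 1) → ℤ) :
    F.latticeTranslation (.ofAdd v) = translation n (.ofAdd (F.period v)) := rfl

theorem latticeTranslation_single (F : Frame M) (i : Fin (2 * n + 1)) :
    F.latticeTranslation (.ofAdd (Pi.single i 1)) = F.g i := by
  have hperiod : F.period (Pi.single i 1) = F.periodVector i := by simp [period]
  ext1 p
  rw [latticeTranslation_ofAdd, hperiod, translation_apply, add_comm]
  rfl

theorem latticeTranslation_injective (F : Frame M) (hM : IsTypeII M) :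
    Function.Injective F.latticeTranslation := by
  obtain ⟨ε, hε, h⟩ :=
    exists_pos_forall_norm_linearCombination_lt (F.linearIndependent_periodVector hM)
  have hperiod : Function.Injective F.period := by
    refine (injective_iff_map_eq_zero _).2 fun v hv => h v ?_
    rw [← period, hv, norm_zero]
    exact hε
  exact (translation_injective n).comp hperiod

theorem g₀_conj_latticeTranslation (F : Frame M) (hM : IsTypeII M)
    (v : Multiplicative (Fin (2 * n + 1) → ℤ)) :
    F.g₀ hM * F.latticeTranslation v * (F.g₀ hM)⁻¹ = F.latticeTranslation
      (.ofAdd (Matrix.toLin' (M : Matrix (Fin (2 * n + 1)) (Fin (2 * n + 1)) ℤ)ᵀ v.toAdd)) := by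
  rw [← ofAdd_toAdd v, latticeTranslation_ofAdd, latticeTranslation_ofAdd, g₀_conj_translation,
    toAdd_ofAdd, Matrix.toLin'_apply, period_transpose_mulVec]

theorem g₀_mem_group (F : Frame M) (hM : IsTypeII M) : F.g₀ hM ∈ F.group hM :=
  Subgroup.subset_closure (Set.mem_insert _ _)

theorem latticeTranslation_mem_group (F : Frame M) (hM : IsTypeII M)
    (v : Multiplicative (Fin (2 * n + 1) → ℤ)) : F.latticeTranslation v ∈ F.group hM := by
  have hv : v = ∏ i, .ofAdd (Pi.single i 1 : Fin (2 * n + 1) → ℤ) ^ (v.toAdd i) := by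
    apply Multiplicative.toAdd.injective
    rw [toAdd_prod]
    simpa using ((Pi.basisFun ℤ (Fin (2 * n + 1))).sum_repr v.toAdd).symm
  change v ∈ (F.group hM).comap F.latticeTranslation
  rw [hv]
  refine Subgroup.prod_mem _ fun i _ => ?_
  rw [Subgroup.mem_comap, map_zpow, latticeTranslation_single]
  exact zpow_mem (Subgroup.subset_closure (Set.mem_insert_of_mem _ (Set.mem_range_self i))) _

theorem exists_eq_of_mem_group (F : Frame M) (hM : IsTypeII M)
    {f : (ℍ × (Fin n → ℂ)) ≃ₜ (ℍ × (Fin n → ℂ))} (hf : f ∈ F.group hM) :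
    ∃ (v : Multiplicative (Fin (2 * n + 1) → ℤ)) (k : ℤ),
      f = F.latticeTranslation v * F.g₀ hM ^ k := by
  have hle : F.group hM ≤ F.latticeTranslation.range ⊔ Subgroup.zpowers (F.g₀ hM) := by
    refine (Subgroup.closure_le _).2 (Set.insert_subset_iff.2
      ⟨Subgroup.mem_sup_right (Subgroup.mem_zpowers _), ?_⟩)
    rintro _ ⟨i, rfl⟩
    exact Subgroup.mem_sup_left ⟨_, F.latticeTranslation_single i⟩
  have hunit : IsUnit (M : Matrix (Fin (2 * n + 1)) (Fin (2 * n + 1)) ℤ)ᵀ := by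
    rw [Matrix.isUnit_iff_isUnit_det, Matrix.det_transpose, M.det_coe]
    exact isUnit_one
  refine exists_eq_mul_zpow_of_mem_sup (fun w => ?_) (F.g₀_conj_latticeTranslation hM) (hle hf)
  obtain ⟨v, hv⟩ := Matrix.mulVec_surjective_iff_isUnit.2 hunit w.toAdd
  exact ⟨.ofAdd v, congrArg Multiplicative.ofAdd hv⟩

theorem coord_g₀_fst (F : Frame M) (hM : IsTypeII M) (p : ℍ × (Fin n → ℂ)) :
    (coord (F.g₀ hM p)).1 = Real.log F.α + (coord p).1 := by
  simp [coord, g₀, Real.log_mul (F.α_pos hM).ne' p.1.im_ne_zero]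

theorem exists_pos_forall_dist_coord_lt (F : Frame M) (hM : IsTypeII M) :
    ∃ ε > 0, ∀ f ∈ F.group hM, ∀ p, dist (coord (f p)) (coord p) < ε → f = 1 := by
  obtain ⟨ε, hε, hperiod⟩ :=
    exists_pos_forall_norm_linearCombination_lt (F.linearIndependent_periodVector hM)
  have hlog : 0 < |Real.log F.α| :=
    abs_pos.2 (Real.log_ne_zero_of_pos_of_ne_one (F.α_pos hM) (F.α_ne_one hM))
  refine ⟨min |Real.log F.α| ε, lt_min hlog hε, fun f hf p hfp => ?_⟩
  obtain ⟨v, k, rfl⟩ := F.exists_eq_of_mem_group hM hf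
  rw [← ofAdd_toAdd v, latticeTranslation_ofAdd, Homeomorph.mul_apply, coord_translation,
    Prod.dist_eq, max_lt_iff] at hfp
  have hk : k = 0 := by
    have hlt := hfp.1.trans_le (min_le_left _ _)
    rw [Prod.fst_add, zero_add, coordinate_zpow_apply (c := fun p => (coord p).1)
      (F.coord_g₀_fst hM), dist_eq_norm, add_sub_cancel_right, Real.norm_eq_abs, zsmul_eq_mul,
      abs_mul, mul_lt_iff_lt_one_left hlog] at hlt
    exact Int.abs_lt_one_iff.1 (by exact_mod_cast hlt)
  subst hk
  have hv : v.toAdd = 0 := by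
    refine hperiod _ ?_
    simpa [dist_eq_norm, period] using hfp.2.trans_le (min_le_right _ _)
  rw [← ofAdd_toAdd v, hv, ofAdd_zero, map_one, zpow_zero, mul_one]

theorem nonempty_fundamentalGroup_mulEquiv_group (F : Frame M) (hM : IsTypeII M) (x : F.T hM) :
    Nonempty (FundamentalGroup (F.T hM) x ≃* F.group hM) := by
  obtain ⟨ε, hε, h⟩ := F.exists_pos_forall_dist_coord_lt hM
  exact nonempty_fundamentalGroup_mulEquiv
    (isQuotientCoveringMap_orbitSpace continuous_coord hε h) x

end Frame

/-! ## The group `U ⋉ 𝓞 K` -/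

section OT

open NumberField

variable {K : Type*} [Field K]

/-- The coordinates `(log Im, Re, z)` on `ℍ^s × ℂ^t`: in the first of them `U ⋉ 𝓞 K` acts by
translations, the kernel of that action being `𝓞 K`, which translates the others. -/
def otCoord (p : OTSpace K) : (RealPlace K → ℝ) × (RealPlace K → ℝ) × (ComplexPlace K → ℂ) :=
  (fun w => Real.log (p.1 w).im, fun w => (p.1 w).re, p.2)

theorem continuous_otCoord : Continuous (otCoord (K := K)) := by
  refine (continuous_pi fun w => ?_).prodMk ((continuous_pi fun w => ?_).prodMk continuous_snd)
  · exact (UpperHalfPlane.continuous_im.comp ((continuous_apply w).comp continuous_fst)).log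
      fun p => (p.1 w).im_ne_zero
  · exact UpperHalfPlane.continuous_re.comp ((continuous_apply w).comp continuous_fst)

theorem otCoord_otTranslation (τ : ComplexPlace K → K →+* ℂ) (ξ : 𝓞 K) (p : OTSpace K) :
    otCoord (otTranslation τ ξ p) =
      (0, fun w => realEmb w (ξ : K), fun w => τ w (ξ : K)) + otCoord p := by
  refine Prod.ext (funext fun w => ?_) (Prod.ext (funext fun w => ?_) (funext fun w => ?_))
  · simp [otCoord, otTranslation]
  · simp [otCoord, otTranslation]
  · simp [otCoord, otTranslation, add_comm]

theorem otCoord_otDilation_fst (τ : ComplexPlace K → K →+* ℂ) (u : positiveUnits K)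
    (p : OTSpace K) : (otCoord (otDilation τ u p)).1 = logReal (.ofMul u) + (otCoord p).1 := by
  funext w
  simp [otCoord, otDilation, posReal, logReal, Real.log_mul (u.2 w).ne' (p.1 w).im_ne_zero]

variable [NumberField K]

theorem otAction_inl (τ : ComplexPlace K → K →+* ℂ) (U : Subgroup (positiveUnits K))
    (ξ : Multiplicative (𝓞 K)) :
    otAction τ U (SemidirectProduct.inl ξ) = otTranslation τ ξ.toAdd := by
  rw [otAction, SemidirectProduct.lift_inl]
  rfl

theorem otCoord_otAction_fst (τ : ComplexPlace K → K →+* ℂ) {U : Subgroup (positiveUnits K)}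
    (g : Multiplicative (𝓞 K) ⋊[otMul U] U) (p : OTSpace K) :
    (otCoord (otAction τ U g p)).1 =
      logReal (.ofMul (g.right : positiveUnits K)) + (otCoord p).1 := by
  change (otCoord (otTranslation τ g.left.toAdd (otDilation τ g.right p))).1 = _
  rw [otCoord_otTranslation, Prod.fst_add, zero_add, otCoord_otDilation_fst]

theorem eq_zero_of_forall_infinitePlace_lt_one {ξ : 𝓞 K}
    (h : ∀ w : InfinitePlace K, w (ξ : K) < 1) : ξ = 0 := by
  by_contra h0
  obtain ⟨w⟩ : Nonempty (InfinitePlace K) := inferInstance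
  exact (h w).not_ge (InfinitePlace.one_le_of_lt_one h0 fun z _ => h z)

open Classical in
theorem eq_zero_of_norm_embeddings_lt_one {τ : ComplexPlace K → K →+* ℂ}
    (hτ : ∀ w, InfinitePlace.mk (τ w) = w.1) {ξ : 𝓞 K} (hreal : ‖fun w => realEmb w (ξ : K)‖ < 1)
    (hcomplex : ‖fun w => τ w (ξ : K)‖ < 1) : ξ = 0 := by
  refine eq_zero_of_forall_infinitePlace_lt_one fun w => ?_
  rcases w.isReal_or_isComplex with hw | hw
  · rw [← InfinitePlace.norm_embedding_of_isReal hw]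
    exact (norm_le_pi_norm (fun w => realEmb w (ξ : K)) ⟨w, hw⟩).trans_lt hreal
  · have happly : w (ξ : K) = ‖τ ⟨w, hw⟩ ξ‖ := by rw [← InfinitePlace.apply, hτ]
    rw [happly]
    exact (norm_le_pi_norm (fun w => τ w (ξ : K)) ⟨w, hw⟩).trans_lt hcomplex

open Classical in
theorem exists_pos_forall_norm_logReal_lt {U : Subgroup (positiveUnits K)}
    (hinj : ∀ u ∈ U, logReal (Additive.ofMul u) = 0 → u = 1)
    (hdisc : DiscreteTopology (logImage U)) :
    ∃ ε > 0, ∀ u ∈ U, ‖logReal (Additive.ofMul u)‖ < ε → u = 1 := by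
  obtain ⟨ε, hε, h⟩ := Metric.exists_ball_inter_eq_singleton_of_mem_discrete
    (isDiscrete_iff_discreteTopology.2 hdisc) (logImage U).zero_mem
  refine ⟨ε, hε, fun u hu hlt => hinj u hu ?_⟩
  exact h.subset ⟨mem_ball_zero_iff.2 hlt, Additive.ofMul u, hu, rfl⟩

open Classical in
theorem exists_pos_forall_dist_otCoord_lt {τ : ComplexPlace K → K →+* ℂ}
    (hτ : ∀ w, InfinitePlace.mk (τ w) = w.1) {U : Subgroup (positiveUnits K)}
    (hinj : ∀ u ∈ U, logReal (Additive.ofMul u) = 0 → u = 1)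
    (hdisc : DiscreteTopology (logImage U)) :
    ∃ ε > 0, ∀ g p, dist (otCoord (otAction τ U g p)) (otCoord p) < ε → g = 1 := by
  obtain ⟨ε, hε, hlog⟩ := exists_pos_forall_norm_logReal_lt hinj hdisc
  refine ⟨min ε 1, lt_min hε one_pos, fun g p hlt => ?_⟩
  rw [Prod.dist_eq, max_lt_iff] at hlt
  have hright : g.right = 1 := by
    refine Subtype.ext (hlog g.right g.right.2 ?_)
    simpa [otCoord_otAction_fst, dist_eq_norm] using hlt.1.trans_le (min_le_left _ _)
  have hg : g = SemidirectProduct.inl g.left := SemidirectProduct.ext rfl hright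
  have hleft := hlt.2.trans_le (min_le_right _ _)
  rw [hg, otAction_inl, otCoord_otTranslation, Prod.snd_add, dist_eq_norm, add_sub_cancel_right,
    Prod.norm_def, max_lt_iff] at hleft
  exact SemidirectProduct.ext (eq_zero_of_norm_embeddings_lt_one hτ hleft.1 hleft.2) hright

theorem nonempty_fundamentalGroup_otManifold_mulEquiv {τ : ComplexPlace K → K →+* ℂ}
    (hτ : ∀ w, InfinitePlace.mk (τ w) = w.1) {U : Subgroup (positiveUnits K)}
    (hinj : ∀ u ∈ U, logReal (Additive.ofMul u) = 0 → u = 1)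
    (hdisc : DiscreteTopology (logImage U)) (y : OTManifold τ U) :
    Nonempty (FundamentalGroup (OTManifold τ U) y ≃* Multiplicative (𝓞 K) ⋊[otMul U] U) := by
  classical
  obtain ⟨ε, hε, h⟩ := exists_pos_forall_dist_otCoord_lt hτ hinj hdisc
  have hfree : Function.Injective (otAction τ U) :=
    (injective_iff_map_eq_one _).2 fun g hg =>
      h g (fun _ => UpperHalfPlane.I, 0) (by simpa [hg] using hε)
  have hrange : ∀ f ∈ (otAction τ U).range, ∀ p,
      dist (otCoord (f p)) (otCoord p) < ε → f = 1 := by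
    rintro _ ⟨g, rfl⟩ p hlt
    rw [h g p hlt, map_one]
  have : ContractibleSpace (RealPlace K → ℍ) := contractibleSpace_pi
  obtain ⟨e⟩ := nonempty_fundamentalGroup_mulEquiv
    (isQuotientCoveringMap_orbitSpace continuous_otCoord hε hrange) y
  exact ⟨e.trans (MonoidHom.ofInjective hfree).symm⟩

end OT

theorem isDiagonalizable_of_injective {n : ℕ}
    {M : Matrix.SpecialLinearGroup (Fin (2 * n + 1)) ℤ} (hM : IsTypeII M) (F : Frame M)
    {K : Type*} [Field K] [CharZero K] {U : Subgroup (positiveUnits K)}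
    {φ : F.group hM →* Multiplicative (𝓞 K) ⋊[otMul U] U} (hφ : Function.Injective φ) :
    IsDiagonalizable M := by
  let ι : Multiplicative (Fin (2 * n + 1) → ℤ) →* F.group hM :=
    F.latticeTranslation.codRestrict _ (F.latticeTranslation_mem_group hM)
  have hι : Function.Injective ι := fun v w h =>
    F.latticeTranslation_injective hM (congrArg Subtype.val h)
  let g₀ : F.group hM := ⟨F.g₀ hM, F.g₀_mem_group hM⟩
  obtain ⟨u, hu⟩ := exists_aeval_minpoly_eq_zero (h := φ.comp ι) (x := φ g₀) (hφ.comp hι)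
    (F.injective_transpose_sub_one hM) fun v => by
      have hconj : g₀ * ι (.ofAdd v) * g₀⁻¹ = ι (.ofAdd (Matrix.toLin' _ v)) :=
        Subtype.ext (F.g₀_conj_latticeTranslation hM (.ofAdd v))
      rw [MonoidHom.comp_apply, MonoidHom.comp_apply, ← hconj, map_mul, map_mul, map_inv]
  refine isDiagonalizable_of_aeval_eq_zero (separable_map_minpoly ℂ u).squarefree ?_
  have htranspose : Polynomial.aeval
      (M : Matrix (Fin (2 * n + 1)) (Fin (2 * n + 1)) ℤ)ᵀ (minpoly ℤ u) = 0 := by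
    refine (Matrix.toLinAlgEquiv' (R := ℤ)).injective ?_
    rw [map_zero, ← hu]
    exact (Polynomial.aeval_algHom_apply (Matrix.toLinAlgEquiv' (R := ℤ)) _ _).symm
  rwa [aeval_transpose, Matrix.transpose_eq_zero] at htranspose

end GenInoue

end

theorem proposition5p3_general (n : ℕ) (M : Matrix.SpecialLinearGroup (Fin (2 * n + 1)) ℤ)
    (hM : GenInoue.IsTypeII M) (hdiag : ¬ GenInoue.IsDiagonalizable M)
    (F : GenInoue.Frame M)
    (K : Type*) [Field K] [NumberField K]
    (τ : GenInoue.ComplexPlace K → K →+* ℂ)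
    (hτ : ∀ w, NumberField.InfinitePlace.mk (τ w) = w.1)
    (U : Subgroup (GenInoue.positiveUnits K))
    (hinj : ∀ u ∈ U, GenInoue.logReal (Additive.ofMul u) = 0 → u = 1)
    (hdisc : DiscreteTopology (GenInoue.logImage U)) (x : F.T hM) (y : GenInoue.OTManifold τ U)
    (φ : FundamentalGroup (F.T hM) x →* FundamentalGroup (GenInoue.OTManifold τ U) y) :
    ¬ Function.Injective φ := by
  intro hφ
  obtain ⟨e₁⟩ := F.nonempty_fundamentalGroup_mulEquiv_group hM x
  obtain ⟨e₂⟩ := GenInoue.nonempty_fundamentalGroup_otManifold_mulEquiv hτ hinj hdisc y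
  exact hdiag (GenInoue.isDiagonalizable_of_injective hM F
    (φ := e₂.toMonoidHom.comp (φ.comp e₁.symm.toMonoidHom))
    (e₂.injective.comp (hφ.comp e₁.symm.injective)))

theorem proposition5p3 (n : ℕ) (M : Matrix.SpecialLinearGroup (Fin (2 * n + 1)) ℤ)
    (hM : GenInoue.IsTypeII M) (hdiag : ¬ GenInoue.IsDiagonalizable M)
    (F : GenInoue.Frame M)
    (K : Type*) [Field K] [NumberField K]
    (τ : GenInoue.ComplexPlace K → K →+* ℂ)
    (hτ : ∀ w, NumberField.InfinitePlace.mk (τ w) = w.1)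
    (U : Subgroup (GenInoue.positiveUnits K)) (hU : GenInoue.IsAdmissible U) :
    (∀ (x : F.T hM) (y : GenInoue.OTManifold τ U),
      IsEmpty (FundamentalGroup (F.T hM) x ≃* FundamentalGroup (GenInoue.OTManifold τ U) y)) ∧
    IsEmpty (F.T hM ≃ₜ GenInoue.OTManifold τ U) := by
  have h := proposition5p3_general n M hM hdiag F K τ hτ U hU.injOn hU.discrete
  exact ⟨fun x y => ⟨fun e => h x y e.toMonoidHom e.injective⟩,
    ⟨fun e => h (Quotient.mk _ (UpperHalfPlane.I, 0)) _ _
      (GenInoue.fundamentalGroup_map_injective e.toHomotopyEquiv _)⟩⟩
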